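/- **Proposition 2.1.** There is an absolute constant $C>0$ with the following property. Let $V=V(T)$ be any real-valued function with $V(T)\to\infty$ as $T\to\infty$. For $T>0$ let $t$ be sampled uniformly from $[T,2T]$, so that $\mathbb P(A)=\frac1T\operatorname{meas}(A)$ for $A\subset[T,2T]$. Then for all sufficiently large $T$ (depending on $V$) $$\mathbb P\Big(\max_{|t-u|\le 1}\big|\zeta(\tfrac12+iu)\big|>V(T)\log T\Big)\le \frac{C}{V(T)^2},$$ that is, this probability is $O(1/V^2)$ with an absolute implied constant, and in particular it is $o(1)$ as $T\to\infty$. -/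

import Mathlib

open Filter Topology

/-- `max_{|t-u| ≤ 1} |ζ(1/2 + iu)|`, as the supremum of a set of reals. The supremum is attained,
see `isGreatest_zetaLocalMax`. -/
noncomputable def zetaLocalMax (t : ℝ) : ℝ :=
  sSup ((fun u : ℝ => ‖riemannZeta (1 / 2 + Complex.I * (u : ℂ))‖) '' {u : ℝ | |t - u| ≤ 1})

/-- The supremum defining `zetaLocalMax t` is a maximum. -/
theorem isGreatest_zetaLocalMax (t : ℝ) :
    IsGreatest ((fun u : ℝ => ‖riemannZeta (1 / 2 + Complex.I * (u : ℂ))‖) '' {u : ℝ | |t - u| ≤ 1})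
      (zetaLocalMax t) := by
  have hset : {u : ℝ | |t - u| ≤ 1} = Metric.closedBall t 1 := by
    ext u
    simp [Real.dist_eq, abs_sub_comm]
  have hc : Continuous fun u : ℝ => ‖riemannZeta (1 / 2 + Complex.I * (u : ℂ))‖ := by
    refine continuous_norm.comp (continuous_iff_continuousAt.2 fun u => ?_)
    have h1 : (1 / 2 + Complex.I * (u : ℂ)) ≠ 1 := by
      intro h
      have := congrArg Complex.re h
      norm_num at this
    exact ContinuousAt.comp (f := fun u : ℝ => (1 / 2 + Complex.I * (u : ℂ)))
      (differentiableAt_riemannZeta h1).continuousAt (by fun_prop)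
  unfold zetaLocalMax
  rw [hset]
  exact ((isCompact_closedBall t 1).image hc).isGreatest_sSup
    ((Metric.nonempty_closedBall.2 zero_le_one).image _)

/-- The probability of an event `A` for `t` uniform on `[T, 2T]`:
`P(A) = (1/T) meas {t ∈ [T, 2T] : t ∈ A}` (used for `T > 0`). -/
noncomputable def unifProb (T : ℝ) (A : Set ℝ) : ℝ :=
  (1 / T) * MeasureTheory.volume.real (Set.Icc T (2 * T) ∩ A)

/-! The event is controlled by subharmonicity of `|ζ|²`, a second moment near the critical line, and
Markov's inequality.

Put `r = 1 / log T`. At the point `1/2 + iu` where the local maximum is attained, `π r² |ζ|²` is at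
most the integral of `|ζ|²` over a square of half-side `r` (`enorm_sq_mul_le_lintegral_square`).
Enlarging the square to the rectangle `|σ - 1/2| ≤ r`, `|v| ≤ 2` around `1/2 + it` removes the
dependence on `u` (`ofReal_zetaLocalMax_sq_mul_le`). After Tonelli, what remains is the bound `O(T
log T)` for the mean square of `ζ` on each vertical line of the rectangle
(`lintegral_enorm_sq_riemannZeta_le`). The rectangle has area `8 / log T`, so the average is `O(1)`,
whereas on the event the local integral is at least `π V² (log T)² r² = π V²`.

For the mean square, `ζ(s)` is within `O(1)` of a Dirichlet polynomial of length about `6T`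
(`norm_riemannZeta_sub_sum_ceil_le`): the series is first cut at about `T²` by comparing sum and
integral, and the terms between `6T` and `T²` are removed by partial summation. The polynomial is
squared out and integrated termwise (`integral_norm_sq_sum_mul_exp_log_le`); as its length is
`O(T)`, the off-diagonal terms are bounded trivially. Since `|σ - 1/2| ≤ 1 / log T`, replacing `n ^
(-σ)` by `n ^ (-1/2)` costs only a constant factor. -/

/-! ### Truncation of the Dirichlet series of `ζ` in the half-plane `0 < re s` -/

/-- `(s - 1) (n ^ (-s) - ∫ x in n..n+1, x ^ (-s))`, in closed form. -/
noncomputable def zetaStep (n : ℕ) (s : ℂ) : ℂ :=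
  (s - 1) * (n : ℂ) ^ (-s) - ((n : ℂ) ^ (1 - s) - ((n + 1 : ℕ) : ℂ) ^ (1 - s))

theorem norm_natCast_cpow_neg_sub_le {n : ℕ} (hn : 0 < n) {s : ℂ} (hs : 0 < s.re) {x : ℝ}
    (hx : x ∈ Set.Icc (n : ℝ) (n + 1)) :
    ‖(n : ℂ) ^ (-s) - (x : ℂ) ^ (-s)‖ ≤ ‖s‖ * (n : ℝ) ^ (-s.re - 1) := by
  have hn' : (0 : ℝ) < n := by exact_mod_cast hn
  have hs0 : -s ≠ 0 := by
    intro h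
    rw [neg_eq_zero] at h
    simp [h] at hs
  have key := (convex_Icc (n : ℝ) (n + 1)).norm_image_sub_le_of_norm_hasDerivWithin_le
    (f := fun y : ℝ => (y : ℂ) ^ (-s)) (f' := fun y : ℝ => -s * (y : ℂ) ^ (-s - 1))
    (C := ‖s‖ * (n : ℝ) ^ (-s.re - 1)) (x := x) (y := n)
    (fun y hy => by
      have hy0 : y ≠ 0 := (hn'.trans_le hy.1).ne'
      exact (hasDerivAt_ofReal_cpow_const hy0 hs0).hasDerivWithinAt)
    (fun y hy => by
      have hy0 : 0 < y := hn'.trans_le hy.1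
      rw [norm_mul, norm_neg, Complex.norm_cpow_eq_rpow_re_of_pos hy0]
      gcongr
      simp only [Complex.sub_re, Complex.neg_re, Complex.one_re]
      exact Real.rpow_le_rpow_of_nonpos hn' hy.1 (by linarith)) hx (by simp)
  have h1 : ‖((n : ℝ)) - x‖ ≤ 1 := by
    rw [Real.norm_eq_abs, abs_le]; constructor <;> linarith [hx.1, hx.2]
  calc _ ≤ _ := by simpa using key
    _ ≤ ‖s‖ * (n : ℝ) ^ (-s.re - 1) * 1 := by gcongr; simpa using h1
    _ = _ := mul_one _

/-- Mean value inequality on `[n, n + 1]` for `y ↦ (s - 1) n ^ (-s) y + y ^ (1 - s)`, whose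
increment is `zetaStep n s` and whose derivative is `(s - 1) (n ^ (-s) - y ^ (-s))`. The extra power
of `n` gained makes the series converge for `re s > 0`. -/
theorem norm_zetaStep_le {n : ℕ} (hn : 0 < n) {s : ℂ} (hs : 0 < s.re) :
    ‖zetaStep n s‖ ≤ ‖s - 1‖ * (‖s‖ * (n : ℝ) ^ (-s.re - 1)) := by
  rcases eq_or_ne s 1 with rfl | hs1
  · simp [zetaStep]
  have hn' : (0 : ℝ) < n := by exact_mod_cast hn
  have key := (convex_Icc (n : ℝ) (n + 1)).norm_image_sub_le_of_norm_hasDerivWithin_le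
    (f := fun y : ℝ => (s - 1) * (n : ℂ) ^ (-s) * (y : ℂ) + (y : ℂ) ^ (1 - s))
    (f' := fun y : ℝ => (s - 1) * (n : ℂ) ^ (-s) * 1 + (1 - s) * (y : ℂ) ^ (1 - s - 1))
    (C := ‖s - 1‖ * (‖s‖ * (n : ℝ) ^ (-s.re - 1))) (x := n) (y := n + 1)
    (fun y hy => by
      have hy0 : y ≠ 0 := (hn'.trans_le hy.1).ne'
      exact (((hasDerivAt_id y).ofReal_comp.const_mul _).add (hasDerivAt_ofReal_cpow_const hy0
        (sub_ne_zero.2 hs1.symm))).hasDerivWithinAt)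
    (fun y hy => by
      have : (s - 1) * (n : ℂ) ^ (-s) * 1 + (1 - s) * (y : ℂ) ^ (1 - s - 1)
          = (s - 1) * ((n : ℂ) ^ (-s) - (y : ℂ) ^ (-s)) := by
        rw [show 1 - s - 1 = -s by ring]; ring
      rw [this, norm_mul]
      gcongr
      exact norm_natCast_cpow_neg_sub_le hn hs hy) (by simp) (by simp)
  refine le_of_eq_of_le ?_ (key.trans_eq (by simp))
  congr 1
  simp only [zetaStep]
  push_cast
  ring

/-- A telescoping majorant, so that tails can be summed without integrals. The factor 4 bounds `((n
+ 1) / n) ^ (σ + 1)`, using `n + 1 ≤ 2n` and `σ ≤ 1`. -/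
theorem rpow_neg_sub_one_le {n : ℕ} (hn : 0 < n) {σ : ℝ} (h0 : 0 < σ) (h1 : σ ≤ 1) :
    (n : ℝ) ^ (-σ - 1) ≤ 4 / σ * ((n : ℝ) ^ (-σ) - ((n + 1 : ℕ) : ℝ) ^ (-σ)) := by
  have hn' : (0 : ℝ) < n := by exact_mod_cast hn
  have hn1 : (1 : ℝ) ≤ n := by exact_mod_cast hn
  have hm : (0 : ℝ) < n + 1 := by linarith
  have hlog : 1 / ((n : ℝ) + 1) ≤ Real.log (n + 1) - Real.log n := by
    have := Real.one_sub_inv_le_log_of_pos (x := ((n : ℝ) + 1) / n) (by positivity)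
    rw [Real.log_div hm.ne' hn'.ne'] at this
    refine le_trans (le_of_eq ?_) this
    field_simp
    ring
  have hA : (n : ℝ) ^ (-σ) ≥ ((n : ℝ) + 1) ^ (-σ) * (1 + σ / (n + 1)) := by
    rw [Real.rpow_def_of_pos hn', Real.rpow_def_of_pos hm]
    calc Real.exp (Real.log n * -σ)
        = Real.exp (Real.log (n + 1) * -σ) * Real.exp (σ * (Real.log (n + 1) - Real.log n)) := by
          rw [← Real.exp_add]; ring_nf
      _ ≥ Real.exp (Real.log (n + 1) * -σ) * (1 + σ / (n + 1)) := by
          gcongr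
          have h2 := Real.add_one_le_exp (σ * (Real.log (n + 1) - Real.log n))
          have h3 : σ * (1 / ((n : ℝ) + 1)) ≤ σ * (Real.log (n + 1) - Real.log n) := by gcongr
          rw [mul_one_div] at h3
          linarith
  have hB : (n : ℝ) ^ (-σ - 1) ≤ 4 * ((n : ℝ) + 1) ^ (-σ - 1) := by
    have h2 : ((2 : ℝ) * n) ^ (-σ - 1) ≤ ((n : ℝ) + 1) ^ (-σ - 1) :=
      Real.rpow_le_rpow_of_nonpos hm (by linarith) (by linarith)
    rw [Real.mul_rpow (by norm_num) hn'.le] at h2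
    have h3 : (2 : ℝ) ^ (-2 : ℝ) ≤ 2 ^ (-σ - 1) :=
      Real.rpow_le_rpow_of_exponent_le (by norm_num) (by linarith)
    have h4 : (2 : ℝ) ^ (-2 : ℝ) = 1 / 4 := by
      rw [Real.rpow_neg (by norm_num)]; norm_num
    have h5 : (0 : ℝ) ≤ (n : ℝ) ^ (-σ - 1) := by positivity
    rw [h4] at h3
    nlinarith [mul_le_mul_of_nonneg_right h3 h5]
  have hC : ((n : ℝ) + 1) ^ (-σ - 1) = ((n : ℝ) + 1) ^ (-σ) / (n + 1) := by
    rw [Real.rpow_sub hm, Real.rpow_one]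
  push_cast
  have hD : σ * ((n : ℝ) + 1) ^ (-σ - 1) ≤ (n : ℝ) ^ (-σ) - ((n : ℝ) + 1) ^ (-σ) := by
    rw [hC]
    have : ((n : ℝ) + 1) ^ (-σ) * (1 + σ / (n + 1))
      = ((n : ℝ) + 1) ^ (-σ) + σ * (((n : ℝ) + 1) ^ (-σ) / (n + 1)) := by ring
    linarith
  rw [div_mul_eq_mul_div, le_div_iff₀ h0]
  nlinarith

theorem summable_natCast_add_rpow (N : ℕ) {ε : ℝ} (hε : 0 < ε) :
    Summable fun k : ℕ => ((N + k : ℕ) : ℝ) ^ (-ε - 1) := by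
  have h := (Real.summable_nat_rpow (p := -ε - 1)).2 (by linarith)
  have h2 := (summable_nat_add_iff N).2 h
  exact h2.congr fun k => by rw [add_comm]

theorem tsum_rpow_neg_sub_one_le {N : ℕ} (hN : 0 < N) {σ : ℝ} (h0 : 0 < σ) (h1 : σ ≤ 1) :
    ∑' k : ℕ, ((N + k : ℕ) : ℝ) ^ (-σ - 1) ≤ 4 / σ * (N : ℝ) ^ (-σ) := by
  refine (summable_natCast_add_rpow N h0).tsum_le_of_sum_range_le fun K => ?_
  calc ∑ k ∈ Finset.range K, ((N + k : ℕ) : ℝ) ^ (-σ - 1)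
      ≤ ∑ k ∈ Finset.range K, 4 / σ * (((N + k : ℕ) : ℝ) ^ (-σ)
          - ((N + (k + 1) : ℕ) : ℝ) ^ (-σ)) :=
        Finset.sum_le_sum fun k _ => rpow_neg_sub_one_le (by omega) h0 h1
    _ = 4 / σ * ((N : ℝ) ^ (-σ) - ((N + K : ℕ) : ℝ) ^ (-σ)) := by
        rw [← Finset.mul_sum, Finset.sum_range_sub' (fun k => ((N + k : ℕ) : ℝ) ^ (-σ))]
        simp
    _ ≤ 4 / σ * (N : ℝ) ^ (-σ) := by
        gcongr
        have : 0 ≤ ((N + K : ℕ) : ℝ) ^ (-σ) := by positivity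
        linarith

theorem differentiable_zetaStep {n : ℕ} (hn : 0 < n) : Differentiable ℂ (zetaStep n) := by
  have h1 : (n : ℂ) ≠ 0 := by exact_mod_cast hn.ne'
  have h2 : ((n + 1 : ℕ) : ℂ) ≠ 0 := by exact_mod_cast n.succ_ne_zero
  unfold zetaStep
  refine Differentiable.sub (Differentiable.mul (by fun_prop) ?_) (Differentiable.sub ?_ ?_)
  · exact Differentiable.const_cpow (by fun_prop) (.inl h1)
  · exact Differentiable.const_cpow (by fun_prop) (.inl h1)
  · exact Differentiable.const_cpow (by fun_prop) (.inl h2)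

theorem summable_zetaStep {N : ℕ} (hN : 0 < N) {s : ℂ} (hs : 0 < s.re) :
    Summable fun k => zetaStep (N + k) s :=
  Summable.of_norm_bounded ((summable_natCast_add_rpow N hs).mul_left (‖s - 1‖ * ‖s‖))
    fun k => (norm_zetaStep_le (by omega) hs).trans_eq (by ring)

theorem sum_zetaStep (N K : ℕ) (s : ℂ) :
    ∑ k ∈ Finset.range K, zetaStep (N + k) s
      = (s - 1) * (∑ n ∈ Finset.range (N + K), (n : ℂ) ^ (-s)
          - ∑ n ∈ Finset.range N, (n : ℂ) ^ (-s))
        - (N : ℂ) ^ (1 - s) + ((N + K : ℕ) : ℂ) ^ (1 - s) := by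
  induction K with
  | zero => simp
  | succ K ih =>
    rw [Finset.sum_range_succ, ih, ← add_assoc, Finset.sum_range_succ, zetaStep]
    ring

theorem tsum_zetaStep_of_one_lt_re {N : ℕ} (hN : 0 < N) {s : ℂ} (hs : 1 < s.re) :
    ∑' k, zetaStep (N + k) s
      = (s - 1) * (riemannZeta s - ∑ n ∈ Finset.range N, (n : ℂ) ^ (-s)) - (N : ℂ) ^ (1 - s) := by
  have h1 := (summable_zetaStep hN (by linarith : 0 < s.re)).hasSum.tendsto_sum_nat
  refine tendsto_nhds_unique h1 ?_
  simp_rw [sum_zetaStep]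
  have hz : HasSum (fun n : ℕ => (n : ℂ) ^ (-s)) (riemannZeta s) := by
    have h2 : Summable fun n : ℕ => (n : ℂ) ^ (-s) := by
      simpa [Complex.cpow_neg] using Complex.summable_one_div_nat_cpow.2 hs
    rw [zeta_eq_tsum_one_div_nat_cpow hs]
    simpa [Complex.cpow_neg] using h2.hasSum
  have hz' : Tendsto (fun K => ∑ n ∈ Finset.range (N + K), (n : ℂ) ^ (-s)) atTop
      (𝓝 (riemannZeta s)) := by
    have := (tendsto_add_atTop_iff_nat N).2 hz.tendsto_sum_nat
    exact this.congr fun K => by rw [add_comm]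
  have hp : Tendsto (fun K : ℕ => ((N + K : ℕ) : ℂ) ^ (1 - s)) atTop (𝓝 0) := by
    rw [tendsto_zero_iff_norm_tendsto_zero]
    have h3 : Tendsto (fun K : ℕ => ((K : ℕ) : ℝ) ^ (-(s.re - 1))) atTop (𝓝 0) :=
      (tendsto_rpow_neg_atTop (by linarith)).comp tendsto_natCast_atTop_atTop
    refine ((tendsto_add_atTop_iff_nat N).2 h3).congr fun K => ?_
    rw [add_comm, Complex.norm_natCast_cpow_of_pos (by omega)]
    congr 1
    simp
  simpa using (((hz'.sub_const _).const_mul (s - 1)).sub_const _).add hp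

/-- Analytic continuation from `re s > 1`, where the partial sums telescope. The factor `s - 1`
built into `zetaStep` cancels the pole, so the domain need not be punctured at 1. -/
theorem tsum_zetaStep {N : ℕ} (hN : 0 < N) {s : ℂ} (hs : 0 < s.re) (hs1 : s ≠ 1) :
    ∑' k, zetaStep (N + k) s
      = (s - 1) * (riemannZeta s - ∑ n ∈ Finset.range N, (n : ℂ) ^ (-s)) - (N : ℂ) ^ (1 - s) := by
  obtain ⟨ε, hε, hεs, hε1⟩ : ∃ ε : ℝ, 0 < ε ∧ ε < s.re ∧ ε < 1 :=
    ⟨min s.re 1 / 2, by positivity, by linarith [min_le_left s.re 1, lt_min hs one_pos],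
      by linarith [min_le_right s.re 1]⟩
  -- Convex, hence connected; bounded and away from `re z = 0`, so that one summable majorant serves
  -- all of `U`; large enough to contain both `s` and 2.
  set U : Set ℂ := {z | ε < z.re} ∩ Metric.ball 0 (‖s‖ + 3) with hU
  have hUo : IsOpen U := (isOpen_lt continuous_const Complex.continuous_re).inter Metric.isOpen_ball
  have hUc : IsPreconnected U :=
    ((convex_halfSpace_re_gt ε).inter (convex_ball _ _)).isPreconnected
  have hsU : s ∈ U := ⟨hεs, by simp⟩
  have h2U : (2 : ℂ) ∈ U := ⟨by simp; linarith, by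
    simp only [Metric.mem_ball, dist_zero_right]; norm_num; linarith [norm_nonneg s]⟩
  have hF : AnalyticOnNhd ℂ (fun z => ∑' k, zetaStep (N + k) z) U := by
    refine DifferentiableOn.analyticOnNhd ?_ hUo
    refine Complex.differentiableOn_tsum_of_summable_norm
      (u := fun k => (‖s‖ + 4) * (‖s‖ + 3) * ((N + k : ℕ) : ℝ) ^ (-ε - 1))
      ((summable_natCast_add_rpow N hε).mul_left _)
      (fun k => (differentiable_zetaStep (by omega)).differentiableOn) hUo fun k z hz => ?_
    have hz2 : ‖z‖ ≤ ‖s‖ + 3 := (mem_ball_zero_iff.1 hz.2).le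
    have hz1 : ε < z.re := hz.1
    have hz3 : ‖z - 1‖ ≤ ‖s‖ + 4 := (norm_sub_le _ _).trans (by simp; linarith)
    refine (norm_zetaStep_le (by omega) (hε.trans hz1)).trans ?_
    rw [← mul_assoc]
    gcongr
    · exact_mod_cast (by omega : 1 ≤ N + k)
  have hN0 : (N : ℂ) ≠ 0 := by exact_mod_cast hN.ne'
  -- The term `n = 0` is left out: `0 ^ (-z)` jumps at `z = 0`, and without it the function is
  -- entire.
  have hG : AnalyticOnNhd ℂ (fun z => riemannZeta₁ z - (z - 1) * ∑ n ∈ Finset.Ico 1 N, (n : ℂ) ^ (-z)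
      - (N : ℂ) ^ (1 - z)) U := by
    refine DifferentiableOn.analyticOnNhd (Differentiable.differentiableOn ?_) hUo
    refine (differentiable_riemannZeta₁.sub (Differentiable.mul (by fun_prop) ?_)).sub
      (Differentiable.const_cpow (by fun_prop) (.inl hN0))
    refine Differentiable.fun_sum fun n hn => Differentiable.const_cpow (by fun_prop) (.inl ?_)
    have := (Finset.mem_Ico.1 hn).1
    exact_mod_cast (by omega : n ≠ 0)
  have hsum : ∀ z : ℂ, z ≠ 0 → ∑ n ∈ Finset.range N, (n : ℂ) ^ (-z)
      = ∑ n ∈ Finset.Ico 1 N, (n : ℂ) ^ (-z) := fun z hz => by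
    rw [Finset.range_eq_Ico, Finset.sum_eq_sum_Ico_succ_bot hN]
    simp [Complex.zero_cpow (neg_ne_zero.2 hz)]
  have hz1 : ∀ z : ℂ, z ≠ 1 → riemannZeta₁ z = (z - 1) * riemannZeta z := fun z hz => by
    rw [riemannZeta_eq_inv_sub_mul hz]
    have := sub_ne_zero.2 hz
    field_simp
  have hev : (fun z => ∑' k, zetaStep (N + k) z) =ᶠ[𝓝 2] fun z => riemannZeta₁ z
      - (z - 1) * ∑ n ∈ Finset.Ico 1 N, (n : ℂ) ^ (-z) - (N : ℂ) ^ (1 - z) := by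
    have : {z : ℂ | 1 < z.re} ∈ 𝓝 (2 : ℂ) :=
      (isOpen_lt continuous_const Complex.continuous_re).mem_nhds (by simp)
    filter_upwards [this] with z hz
    have hz' : (1 : ℝ) < z.re := hz
    have hne1 : z ≠ 1 := by rintro rfl; simp at hz'
    have hne0 : z ≠ 0 := by rintro rfl; simp at hz'; linarith
    rw [tsum_zetaStep_of_one_lt_re hN hz', hz1 z hne1, hsum z hne0]
    ring
  have hne0 : s ≠ 0 := by rintro rfl; simp at hs
  have := hF.eqOn_of_preconnected_of_eventuallyEq hG hUc h2U hev hsU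
  simp only at this
  rw [this, hz1 s hs1, hsum s hne0]
  ring

theorem norm_riemannZeta_sub_sum_le {N : ℕ} (hN : 0 < N) {s : ℂ} (hs : 0 < s.re) (hs' : s.re ≤ 1)
    (hs1 : s ≠ 1) :
    ‖riemannZeta s - ∑ n ∈ Finset.range N, (n : ℂ) ^ (-s)‖
      ≤ (N : ℝ) ^ (1 - s.re) / ‖s - 1‖ + ‖s‖ * (4 / s.re * (N : ℝ) ^ (-s.re)) := by
  have hs0 : 0 < ‖s - 1‖ := norm_pos_iff.2 (sub_ne_zero.2 hs1)
  set D := riemannZeta s - ∑ n ∈ Finset.range N, (n : ℂ) ^ (-s) with hD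
  have h := tsum_zetaStep hN hs hs1
  have hb : ‖∑' k, zetaStep (N + k) s‖ ≤ ‖s - 1‖ * ‖s‖ * (4 / s.re * (N : ℝ) ^ (-s.re)) := by
    refine (tsum_of_norm_bounded ((summable_natCast_add_rpow N hs).mul_left
      (‖s - 1‖ * ‖s‖)).hasSum fun k => (norm_zetaStep_le (by omega) hs).trans_eq (by ring)).trans ?_
    rw [tsum_mul_left]
    gcongr
    exact tsum_rpow_neg_sub_one_le hN hs hs'
  have h3 : (s - 1) * D = ∑' k, zetaStep (N + k) s + (N : ℂ) ^ (1 - s) := by rw [h]; ring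
  have h4 : ‖s - 1‖ * ‖D‖
      ≤ ‖s - 1‖ * ‖s‖ * (4 / s.re * (N : ℝ) ^ (-s.re)) + (N : ℝ) ^ (1 - s.re) := by
    rw [← norm_mul, h3]
    refine (norm_add_le _ _).trans (add_le_add hb ?_)
    rw [Complex.norm_natCast_cpow_of_pos hN]
    simp
  calc ‖D‖ = (‖s - 1‖ * ‖D‖) / ‖s - 1‖ := by field_simp
    _ ≤ (‖s - 1‖ * ‖s‖ * (4 / s.re * (N : ℝ) ^ (-s.re)) + (N : ℝ) ^ (1 - s.re)) / ‖s - 1‖ := by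
        gcongr
    _ = _ := by field_simp; ring

/-! ### The sum `∑ n ^ (-s)` over a range `|s| ≪ n` -/

/-- `log (1 + 1 / n)`. -/
noncomputable def logStep (n : ℕ) : ℝ := Real.log (n + 1) - Real.log n

theorem logStep_le {n : ℕ} (hn : 0 < n) : logStep n ≤ 1 / n := by
  have hn' : (0 : ℝ) < n := by exact_mod_cast hn
  have := Real.log_le_sub_one_of_pos (x := ((n : ℝ) + 1) / n) (by positivity)
  rw [Real.log_div (by positivity) hn'.ne'] at this
  exact this.trans_eq (by field_simp; ring)

theorem le_logStep {n : ℕ} (hn : 0 < n) : 1 / (2 * n) ≤ logStep n := by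
  have hn' : (1 : ℝ) ≤ n := by exact_mod_cast hn
  have := Real.one_sub_inv_le_log_of_pos (x := ((n : ℝ) + 1) / n) (by positivity)
  rw [Real.log_div (by positivity) (by positivity)] at this
  refine le_trans ?_ this
  rw [inv_div, one_sub_div (by positivity), div_le_div_iff₀ (by positivity) (by positivity)]
  linarith

theorem abs_logStep_sub_le {n : ℕ} (hn : 0 < n) :
    |logStep n - logStep (n + 1)| ≤ 1 / (n : ℝ) ^ 2 := by
  have hn' : (0 : ℝ) < n := by exact_mod_cast hn
  have e : logStep n - logStep (n + 1)
      = Real.log (((n : ℝ) + 1) ^ 2 / (n * (n + 2))) := by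
    rw [Real.log_div (by positivity) (by positivity), Real.log_pow,
      Real.log_mul (by positivity) (by positivity), logStep, logStep]
    push_cast
    rw [show (n : ℝ) + 1 + 1 = n + 2 by ring]
    ring
  rw [e, abs_of_nonneg (Real.log_nonneg _)]
  · refine (Real.log_le_sub_one_of_pos (by positivity)).trans ?_
    rw [div_sub_one (by positivity), div_le_div_iff₀ (by positivity) (by positivity)]
    nlinarith [mul_pos hn' hn']
  · rw [le_div_iff₀ (by positivity)]
    nlinarith

/-- The second-order Taylor remainder is at most `‖w‖² ≤ ‖w‖ / 2`. -/
theorem half_norm_le_norm_one_sub_exp {w : ℂ} (hw : ‖w‖ ≤ 1 / 2) :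
    ‖w‖ / 2 ≤ ‖1 - Complex.exp (-w)‖ := by
  have h := Complex.norm_exp_sub_one_sub_id_le (x := -w) (by rw [norm_neg]; linarith)
  have h2 : ‖w‖ ≤ ‖1 - Complex.exp (-w)‖ + ‖Complex.exp (-w) - 1 - -w‖ := by
    calc ‖w‖ = ‖(1 - Complex.exp (-w)) + (Complex.exp (-w) - 1 - -w)‖ := by congr 1; ring
      _ ≤ _ := norm_add_le _ _
  rw [norm_neg] at h
  nlinarith [norm_nonneg w]

theorem norm_exp_neg_sub_exp_neg_le {w z : ℂ} (hw : ‖w‖ ≤ 1 / 2) (hz : ‖z‖ ≤ 1 / 2) :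
    ‖Complex.exp (-w) - Complex.exp (-z)‖ ≤ 4 * ‖w - z‖ := by
  have h1 : Complex.exp (-w) - Complex.exp (-z)
      = Complex.exp (-z) * (Complex.exp (z - w) - 1) := by
    rw [mul_sub, ← Complex.exp_add]; ring_nf
  have hzw : ‖z - w‖ ≤ 1 := (norm_sub_le _ _).trans (by linarith)
  have h2 := Complex.norm_exp_sub_one_le hzw
  have h3 : ‖Complex.exp (-z)‖ ≤ 2 := by
    have h4 : ‖Complex.exp (-z) - 1‖ ≤ 2 * ‖-z‖ :=
      Complex.norm_exp_sub_one_le (by rw [norm_neg]; linarith)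
    rw [norm_neg] at h4
    calc ‖Complex.exp (-z)‖ = ‖(Complex.exp (-z) - 1) + 1‖ := by ring_nf
      _ ≤ ‖Complex.exp (-z) - 1‖ + ‖(1 : ℂ)‖ := norm_add_le _ _
      _ ≤ 2 := by rw [norm_one]; linarith
  rw [h1, norm_mul, norm_sub_rev w z]
  calc _ ≤ 2 * (2 * ‖z - w‖) := by gcongr
    _ = _ := by ring

/-- `1 / (1 - (1 + 1 / n) ^ (-s))`, the factor such that
`n ^ (-s) = (n ^ (-s) - (n + 1) ^ (-s)) * abelWeight s n`. -/
noncomputable def abelWeight (s : ℂ) (n : ℕ) : ℂ := (1 - Complex.exp (-(s * logStep n)))⁻¹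

theorem natCast_succ_cpow_neg {n : ℕ} (hn : 0 < n) (s : ℂ) :
    ((n + 1 : ℕ) : ℂ) ^ (-s) = (n : ℂ) ^ (-s) * Complex.exp (-(s * logStep n)) := by
  have h1 : (n : ℂ) ≠ 0 := by exact_mod_cast hn.ne'
  have h2 : ((n + 1 : ℕ) : ℂ) ≠ 0 := by exact_mod_cast n.succ_ne_zero
  rw [Complex.cpow_def_of_ne_zero h1, Complex.cpow_def_of_ne_zero h2, ← Complex.exp_add, logStep,
    ← Complex.ofReal_natCast (n + 1), ← Complex.ofReal_natCast n,
    ← Complex.ofReal_log (by positivity), ← Complex.ofReal_log (by positivity)]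
  push_cast
  ring_nf

section

variable {s : ℂ} {n : ℕ}

theorem norm_mul_logStep_le (hn : 0 < n) (hs : 2 * ‖s‖ ≤ n) : ‖s * logStep n‖ ≤ 1 / 2 := by
  have hn' : (0 : ℝ) < n := by exact_mod_cast hn
  have h0 : 0 ≤ logStep n := le_trans (by positivity) (le_logStep hn)
  rw [norm_mul, Complex.norm_real, Real.norm_of_nonneg h0]
  calc ‖s‖ * logStep n ≤ ‖s‖ * (1 / n) := by gcongr; exact logStep_le hn
    _ = ‖s‖ / n := by ring
    _ ≤ 1 / 2 := by rw [div_le_div_iff₀ hn' (by norm_num)]; linarith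

theorem le_norm_one_sub_exp_logStep (hn : 0 < n) (hs : 2 * ‖s‖ ≤ n) :
    ‖s‖ / (4 * n) ≤ ‖1 - Complex.exp (-(s * logStep n))‖ := by
  have h0 : 0 ≤ logStep n := le_trans (by positivity) (le_logStep hn)
  refine le_trans ?_ (half_norm_le_norm_one_sub_exp (norm_mul_logStep_le hn hs))
  rw [norm_mul, Complex.norm_real, Real.norm_of_nonneg h0]
  have := mul_le_mul_of_nonneg_left (le_logStep hn) (norm_nonneg s)
  calc ‖s‖ / (4 * n) = ‖s‖ * (1 / (2 * n)) / 2 := by ring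
    _ ≤ _ := by gcongr

theorem norm_abelWeight_le (hn : 0 < n) (hs0 : s ≠ 0) (hs : 2 * ‖s‖ ≤ n) :
    ‖abelWeight s n‖ ≤ 4 * n / ‖s‖ := by
  have hs' := norm_pos_iff.2 hs0
  have hn' : (0 : ℝ) < n := by exact_mod_cast hn
  rw [abelWeight, norm_inv, ← inv_div]
  exact inv_anti₀ (by positivity) (le_norm_one_sub_exp_logStep hn hs)

theorem natCast_cpow_neg_eq_sub_mul_abelWeight (hn : 0 < n) (hs0 : s ≠ 0) (hs : 2 * ‖s‖ ≤ n) :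
    (n : ℂ) ^ (-s) = ((n : ℂ) ^ (-s) - ((n + 1 : ℕ) : ℂ) ^ (-s)) * abelWeight s n := by
  have hs' := norm_pos_iff.2 hs0
  have hn' : (0 : ℝ) < n := by exact_mod_cast hn
  have h : 1 - Complex.exp (-(s * logStep n)) ≠ 0 :=
    norm_pos_iff.1 ((by positivity : 0 < ‖s‖ / (4 * n)).trans_le (le_norm_one_sub_exp_logStep hn hs))
  rw [natCast_succ_cpow_neg hn, abelWeight]
  field_simp

/-- In `1/a - 1/b = (b - a) / (ab)` the numerator is `O(‖s‖ / n²)`, by the second difference of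
`log`, and each factor of the denominator is at least of order `‖s‖ / n`; the powers of `n` cancel.
-/
theorem norm_abelWeight_sub_le (hn : 0 < n) (hs0 : s ≠ 0) (hs : 2 * ‖s‖ ≤ n) :
    ‖abelWeight s (n + 1) - abelWeight s n‖ ≤ 128 / ‖s‖ := by
  have hs' := norm_pos_iff.2 hs0
  have hn' : (1 : ℝ) ≤ n := by exact_mod_cast hn
  have hs2 : 2 * ‖s‖ ≤ ((n + 1 : ℕ) : ℝ) := hs.trans (by push_cast; linarith)
  have p1 : 0 < ‖s‖ / (4 * n) := by positivity
  have p2 : 0 < ‖s‖ / (4 * (n + 1 : ℕ)) := by positivity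
  have q1 := le_norm_one_sub_exp_logStep hn hs
  have q2 := le_norm_one_sub_exp_logStep n.succ_pos hs2
  have h1 := norm_pos_iff.1 (p1.trans_le q1)
  have h2 := norm_pos_iff.1 (p2.trans_le q2)
  have e := norm_exp_neg_sub_exp_neg_le (norm_mul_logStep_le n.succ_pos hs2)
    (norm_mul_logStep_le hn hs)
  rw [abelWeight, abelWeight, inv_sub_inv h2 h1, norm_div, norm_mul]
  have e2 : ‖s * logStep (n + 1) - s * logStep n‖ ≤ ‖s‖ * (1 / (n : ℝ) ^ 2) := by
    rw [← mul_sub, norm_mul, ← Complex.ofReal_sub, Complex.norm_real, Real.norm_eq_abs,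
      abs_sub_comm]
    gcongr
    exact abs_logStep_sub_le hn
  have hnum : ‖1 - Complex.exp (-(s * logStep n)) - (1 - Complex.exp (-(s * logStep (n + 1))))‖
      ≤ 4 * (‖s‖ * (1 / (n : ℝ) ^ 2)) := by
    rw [sub_sub_sub_cancel_left]
    exact e.trans (by gcongr)
  calc _ ≤ 4 * (‖s‖ * (1 / (n : ℝ) ^ 2)) / (‖s‖ / (4 * (n + 1 : ℕ)) * (‖s‖ / (4 * n))) := by
        gcongr
    _ = 64 * ((n + 1) / n) / ‖s‖ := by push_cast; field_simp; ring
    _ ≤ 128 / ‖s‖ := by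
        gcongr
        have : ((n : ℝ) + 1) / n ≤ 2 := by rw [div_le_iff₀ (by positivity)]; linarith
        linarith

/-- Summation by parts: `a n` is minus the increment of `a * c` plus `a (n + 1) * (c (n + 1) - c
n)`. -/
theorem norm_sum_Ico_add_le (a c : ℕ → ℂ) {N M : ℕ} (hNM : N ≤ M)
    (h : ∀ n ∈ Finset.Ico N M, a n = (a n - a (n + 1)) * c n) :
    ‖∑ n ∈ Finset.Ico N M, a n + (a M * c M - a N * c N)‖
      ≤ ∑ n ∈ Finset.Ico N M, ‖a (n + 1)‖ * ‖c (n + 1) - c n‖ := by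
  have : ∑ n ∈ Finset.Ico N M, a n + (a M * c M - a N * c N)
      = ∑ n ∈ Finset.Ico N M, a (n + 1) * (c (n + 1) - c n) := by
    rw [← Finset.sum_Ico_sub (fun n => a n * c n) hNM, ← Finset.sum_add_distrib]
    refine Finset.sum_congr rfl fun n hn => ?_
    linear_combination h n hn
  rw [this]
  exact (norm_sum_le _ _).trans_eq (by simp)

theorem sum_Ico_rpow_neg_half_le (N M : ℕ) :
    ∑ n ∈ Finset.Ico N M, ((n + 1 : ℕ) : ℝ) ^ (-(1 / 2) : ℝ) ≤ 2 * (M : ℝ) ^ (1 / 2 : ℝ) := by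
  have h : ∀ n : ℕ, ((n + 1 : ℕ) : ℝ) ^ (-(1 / 2) : ℝ)
      ≤ 2 * Real.sqrt ((n + 1 : ℕ) : ℝ) - 2 * Real.sqrt n := fun n => by
    rw [Real.rpow_neg (by positivity), ← Real.sqrt_eq_rpow]
    have h1 : 0 < Real.sqrt ((n + 1 : ℕ) : ℝ) := Real.sqrt_pos.2 (by positivity)
    have h2 := Real.sq_sqrt (by positivity : (0 : ℝ) ≤ ((n + 1 : ℕ) : ℝ))
    have h3 := Real.sq_sqrt (by positivity : (0 : ℝ) ≤ n)
    rw [inv_le_iff_one_le_mul₀ h1]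
    push_cast at *
    nlinarith [sq_nonneg (Real.sqrt ((n : ℝ) + 1) - Real.sqrt n)]
  rw [← Real.sqrt_eq_rpow]
  calc _ ≤ ∑ n ∈ Finset.range M, ((n + 1 : ℕ) : ℝ) ^ (-(1 / 2) : ℝ) :=
        Finset.sum_le_sum_of_subset_of_nonneg
          (fun x hx => Finset.mem_range.2 (Finset.mem_Ico.1 hx).2) fun _ _ _ => by positivity
    _ ≤ ∑ n ∈ Finset.range M, (2 * Real.sqrt ((n + 1 : ℕ) : ℝ) - 2 * Real.sqrt n) :=
        Finset.sum_le_sum fun n _ => h n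
    _ = _ := by
        rw [Finset.sum_range_sub (fun n : ℕ => 2 * Real.sqrt (n : ℝ))]; simp

/-- For `n ≥ 2‖s‖` the terms turn slowly, so the sum behaves like the integral of `x ^ (-s)` and is
smaller by a factor `1 / ‖s‖` than `M · M ^ (-1/2)`. In `264 = 256 + 4 + 4`, the 256 comes from the
variation of the weights and each 4 from an endpoint. -/
theorem norm_sum_Ico_cpow_neg_le {N M : ℕ} (hN : 0 < N) (hNM : N ≤ M) (hs0 : s ≠ 0)
    (hs : 2 * ‖s‖ ≤ N) {A : ℝ}
    (hA : ∀ n : ℕ, 0 < n → n ≤ M → (n : ℝ) ^ (-s.re) ≤ A * (n : ℝ) ^ (-(1 / 2) : ℝ)) :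
    ‖∑ n ∈ Finset.Ico N M, (n : ℂ) ^ (-s)‖ ≤ 264 * A * (M : ℝ) ^ (1 / 2 : ℝ) / ‖s‖ := by
  have hs' := norm_pos_iff.2 hs0
  have hbig : ∀ n, N ≤ n → 2 * ‖s‖ ≤ (n : ℝ) := fun n hn => hs.trans (by exact_mod_cast hn)
  have hA0 : 0 ≤ A := by
    have := hA 1 one_pos (by omega)
    simp at this
    linarith
  have hn1 : ∀ n : ℕ, 0 < n → ‖(n : ℂ) ^ (-s)‖ = (n : ℝ) ^ (-s.re) := fun n hn => by
    rw [Complex.norm_natCast_cpow_of_pos hn, Complex.neg_re]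
  have h1 := norm_sum_Ico_add_le (fun n => (n : ℂ) ^ (-s)) (abelWeight s) hNM fun n hn => by
    have := (Finset.mem_Ico.1 hn).1
    exact natCast_cpow_neg_eq_sub_mul_abelWeight (by omega) hs0 (hbig n this)
  have h2 : ∑ n ∈ Finset.Ico N M, ‖((n + 1 : ℕ) : ℂ) ^ (-s)‖ *
      ‖abelWeight s (n + 1) - abelWeight s n‖ ≤ 256 * A * (M : ℝ) ^ (1 / 2 : ℝ) / ‖s‖ := by
    calc _ ≤ ∑ n ∈ Finset.Ico N M,
          A * ((n + 1 : ℕ) : ℝ) ^ (-(1 / 2) : ℝ) * (128 / ‖s‖) := by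
          refine Finset.sum_le_sum fun n hn => ?_
          obtain ⟨m1, m2⟩ := Finset.mem_Ico.1 hn
          rw [hn1 _ n.succ_pos]
          gcongr
          · exact hA _ n.succ_pos m2
          · exact norm_abelWeight_sub_le (by omega) hs0 (hbig n m1)
      _ = A * (128 / ‖s‖) * ∑ n ∈ Finset.Ico N M, ((n + 1 : ℕ) : ℝ) ^ (-(1 / 2) : ℝ) := by
          rw [Finset.mul_sum]
          exact Finset.sum_congr rfl fun n _ => by ring
      _ ≤ A * (128 / ‖s‖) * (2 * (M : ℝ) ^ (1 / 2 : ℝ)) := by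
          gcongr
          exact sum_Ico_rpow_neg_half_le N M
      _ = _ := by ring
  have h3 : ∀ n : ℕ, N ≤ n → n ≤ M →
      ‖(n : ℂ) ^ (-s) * abelWeight s n‖ ≤ 4 * A * (M : ℝ) ^ (1 / 2 : ℝ) / ‖s‖ := by
    intro n m1 m2
    have hn0 : 0 < n := by omega
    have hn' : (0 : ℝ) < n := by exact_mod_cast hn0
    rw [norm_mul, hn1 n hn0]
    calc _ ≤ A * (n : ℝ) ^ (-(1 / 2) : ℝ) * (4 * n / ‖s‖) := by
          gcongr
          · exact hA n hn0 m2
          · exact norm_abelWeight_le hn0 hs0 (hbig n m1)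
      _ = 4 * A * ((n : ℝ) ^ (-(1 / 2) : ℝ) * (n : ℝ) ^ (1 : ℝ)) / ‖s‖ := by
          rw [Real.rpow_one]; ring
      _ = 4 * A * (n : ℝ) ^ (1 / 2 : ℝ) / ‖s‖ := by
          rw [← Real.rpow_add hn']; norm_num
      _ ≤ _ := by gcongr
  have h4 := h3 M hNM le_rfl
  have h5 := h3 N le_rfl hNM
  set S := ∑ n ∈ Finset.Ico N M, (n : ℂ) ^ (-s)
  have h6 : ‖S‖ ≤ ‖S + ((M : ℂ) ^ (-s) * abelWeight s M - (N : ℂ) ^ (-s) * abelWeight s N)‖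
      + (‖(M : ℂ) ^ (-s) * abelWeight s M‖ + ‖(N : ℂ) ^ (-s) * abelWeight s N‖) := by
    refine le_trans ?_ (add_le_add le_rfl (norm_sub_le _ _))
    refine le_trans (le_of_eq ?_) (norm_sub_le _ _)
    rw [add_sub_cancel_right]
  have e : 264 * A * (M : ℝ) ^ (1 / 2 : ℝ) / ‖s‖ = 256 * A * (M : ℝ) ^ (1 / 2 : ℝ) / ‖s‖
      + (4 * A * (M : ℝ) ^ (1 / 2 : ℝ) / ‖s‖ + 4 * A * (M : ℝ) ^ (1 / 2 : ℝ) / ‖s‖) := by ring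
  rw [e]
  exact h6.trans (add_le_add (h1.trans h2) (add_le_add h4 h5))

end

theorem rpow_neg_le_exp_three_mul {T σ x : ℝ} (hT : 1 < T) (hσ : |σ - 1 / 2| ≤ 1 / Real.log T)
    (hx : 1 ≤ x) (hxT : x ≤ T ^ 3) :
    x ^ (-σ) ≤ Real.exp 3 * x ^ (-(1 / 2) : ℝ) := by
  have hx0 : 0 < x := by linarith
  have hl : 0 < Real.log T := Real.log_pos hT
  have hlx : 0 ≤ Real.log x := Real.log_nonneg hx
  have hlog : Real.log x ≤ 3 * Real.log T := by
    have := Real.log_le_log hx0 hxT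
    rwa [Real.log_pow, Nat.cast_ofNat] at this
  rw [Real.rpow_def_of_pos hx0, Real.rpow_def_of_pos hx0, ← Real.exp_add, Real.exp_le_exp]
  have h1 : Real.log x * (1 / 2 - σ) ≤ 3 * Real.log T * (1 / Real.log T) := by
    calc Real.log x * (1 / 2 - σ) ≤ Real.log x * |σ - 1 / 2| := by
          gcongr
          rw [abs_sub_comm]
          exact le_abs_self _
      _ ≤ _ := by gcongr
  have h2 : 3 * Real.log T * (1 / Real.log T) = 3 := by field_simp
  linarith

theorem four_le_log {T : ℝ} (hT : 100 ≤ T) : 4 ≤ Real.log T := by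
  rw [Real.le_log_iff_exp_le (by linarith)]
  have h := Real.exp_one_lt_d9
  calc Real.exp 4 = Real.exp 1 ^ 4 := by rw [← Real.exp_nat_mul]; norm_num
    _ ≤ 3 ^ 4 := by gcongr; linarith
    _ ≤ T := by norm_num; linarith

/-- Approximation of `ζ` by a Dirichlet polynomial of length `≍ |s|` near the critical line. -/
theorem norm_riemannZeta_sub_sum_ceil_le {T σ y : ℝ} (hT : 100 ≤ T)
    (hσ : |σ - 1 / 2| ≤ 1 / Real.log T) (hy : T - 2 ≤ y) (hy' : y ≤ 2 * T + 2) :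
    ‖riemannZeta (σ + Complex.I * y)
      - ∑ n ∈ Finset.range ⌈6 * T⌉₊, ((n + 1 : ℕ) : ℂ) ^ (-(σ + Complex.I * y))‖
      ≤ 1108 * Real.exp 3 := by
  set s : ℂ := σ + Complex.I * y with hs
  have hre : s.re = σ := by simp [hs]
  have him : s.im = y := by simp [hs]
  have hl := four_le_log hT
  have hr : 1 / Real.log T ≤ 1 / 4 := one_div_le_one_div_of_le (by norm_num) hl
  obtain ⟨hσ1, hσ2⟩ := abs_le.1 (hσ.trans hr)
  have hslow : T / 2 ≤ ‖s‖ := by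
    refine le_trans ?_ (Complex.abs_im_le_norm s)
    rw [him]
    exact le_trans (by linarith) (le_abs_self y)
  have hslow1 : T / 2 ≤ ‖s - 1‖ := by
    refine le_trans ?_ (Complex.abs_im_le_norm (s - 1))
    simp only [Complex.sub_im, Complex.one_im, sub_zero]
    rw [him]
    exact le_trans (by linarith) (le_abs_self y)
  have hsup : ‖s‖ ≤ 3 * T := by
    refine (Complex.norm_le_abs_re_add_abs_im s).trans ?_
    rw [hre, him, abs_of_nonneg (by linarith), abs_of_nonneg (by linarith)]
    linarith
  have hs0 : s ≠ 0 := norm_pos_iff.1 (by linarith)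
  have hs1 : s ≠ 1 := sub_ne_zero.1 (norm_pos_iff.1 (by linarith))
  -- Since `‖s‖ ≤ 3 * T`, this ensures `2 * ‖s‖ ≤ K`, as partial summation beyond `K` requires.
  set K := ⌈6 * T⌉₊ with hK
  have hK1 : 6 * T ≤ K := Nat.le_ceil _
  have hK2 : (K : ℝ) < 6 * T + 1 := Nat.ceil_lt_add_one (by linarith)
  -- At this size both `M ^ (1/2) / ‖s‖` and `‖s‖ * M ^ (-1/2)` are bounded. The three errors `b1`,
  -- `b2`, `b3` add up to `4 + 48 + 1056 = 1108`.
  set M := ⌈T ^ 2⌉₊ with hM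
  have hM1 : T ^ 2 ≤ M := Nat.le_ceil _
  have hM2 : (M : ℝ) < T ^ 2 + 1 := Nat.ceil_lt_add_one (by positivity)
  have hKM : K + 1 ≤ M := by
    have : ((K + 1 : ℕ) : ℝ) ≤ M := by push_cast; nlinarith
    exact_mod_cast this
  have hM0 : 0 < M := by omega
  have hMpos : (0 : ℝ) < M := by exact_mod_cast hM0
  have hMT3 : (M : ℝ) ≤ T ^ 3 := by
    have : T ^ 2 + 1 ≤ T ^ 3 := by nlinarith [sq_nonneg T]
    linarith
  have hA : ∀ n : ℕ, 0 < n → n ≤ M →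
      (n : ℝ) ^ (-s.re) ≤ Real.exp 3 * (n : ℝ) ^ (-(1 / 2) : ℝ) := fun n hn hnM => by
    rw [hre]
    exact rpow_neg_le_exp_three_mul (by linarith) hσ (by exact_mod_cast hn)
      (le_trans (by exact_mod_cast hnM) hMT3)
  have hMh : (M : ℝ) ^ (1 / 2 : ℝ) ≤ 2 * T := by
    rw [← Real.sqrt_eq_rpow]
    exact Real.sqrt_le_iff.2 ⟨by linarith, by nlinarith⟩
  have hMh' : (M : ℝ) ^ (-(1 / 2) : ℝ) ≤ 1 / T := by
    rw [Real.rpow_neg hMpos.le, ← Real.sqrt_eq_rpow, ← one_div]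
    exact one_div_le_one_div_of_le (by linarith) (Real.le_sqrt_of_sq_le hM1)
  have hMs := hA M hM0 le_rfl
  have e1 := norm_riemannZeta_sub_sum_le hM0 (s := s) (by linarith) (by linarith) hs1
  have e2 := norm_sum_Ico_cpow_neg_le (s := s) K.succ_pos hKM hs0
    (by push_cast; linarith) hA
  have hM1s : (M : ℝ) ^ (1 - s.re) ≤ Real.exp 3 * (2 * T) := by
    rw [sub_eq_add_neg, Real.rpow_add hMpos, Real.rpow_one]
    calc (M : ℝ) * (M : ℝ) ^ (-s.re) ≤ M * (Real.exp 3 * (M : ℝ) ^ (-(1 / 2) : ℝ)) := by gcongr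
      _ = Real.exp 3 * ((M : ℝ) ^ (1 : ℝ) * (M : ℝ) ^ (-(1 / 2) : ℝ)) := by
          rw [Real.rpow_one]; ring
      _ = Real.exp 3 * (M : ℝ) ^ (1 / 2 : ℝ) := by rw [← Real.rpow_add hMpos]; norm_num
      _ ≤ _ := by gcongr
  have b1 : (M : ℝ) ^ (1 - s.re) / ‖s - 1‖ ≤ 4 * Real.exp 3 := by
    rw [div_le_iff₀ (by linarith)]
    nlinarith [Real.exp_pos 3]
  have b2 : ‖s‖ * (4 / s.re * (M : ℝ) ^ (-s.re)) ≤ 48 * Real.exp 3 := by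
    have : 4 / s.re ≤ 16 := by
      rw [div_le_iff₀ (by linarith)]; linarith
    calc _ ≤ 3 * T * (16 * (Real.exp 3 * (1 / T))) := by
          have h4 : 0 ≤ 4 / s.re := div_nonneg (by norm_num) (by linarith)
          gcongr
          exact hMs.trans (by gcongr)
      _ = _ := by field_simp; ring
  have b3 : 264 * Real.exp 3 * (M : ℝ) ^ (1 / 2 : ℝ) / ‖s‖ ≤ 1056 * Real.exp 3 := by
    rw [div_le_iff₀ (by linarith)]
    nlinarith [Real.exp_pos 3]
  have hsplit : ∑ n ∈ Finset.range M, (n : ℂ) ^ (-s)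
      = ∑ n ∈ Finset.range K, ((n + 1 : ℕ) : ℂ) ^ (-s)
        + ∑ n ∈ Finset.Ico (K + 1) M, (n : ℂ) ^ (-s) := by
    rw [← Finset.sum_range_add_sum_Ico _ hKM, Finset.sum_range_succ']
    simp [Complex.zero_cpow (neg_ne_zero.2 hs0)]
  have e3 : riemannZeta s - ∑ n ∈ Finset.range K, ((n + 1 : ℕ) : ℂ) ^ (-s)
      = (riemannZeta s - ∑ n ∈ Finset.range M, (n : ℂ) ^ (-s))
        + ∑ n ∈ Finset.Ico (K + 1) M, (n : ℂ) ^ (-s) := by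
    rw [hsplit]; ring
  rw [e3]
  refine (norm_add_le _ _).trans ?_
  linarith

/-! ### Mean squares of Dirichlet polynomials -/

theorem norm_sq_sum_mul_exp (c l : ℕ → ℝ) (K : ℕ) (y : ℝ) :
    ‖∑ n ∈ Finset.range K, (c n : ℂ) * Complex.exp (-(y * l n : ℝ) * Complex.I)‖ ^ 2
      = ∑ m ∈ Finset.range K, ∑ n ∈ Finset.range K, c m * c n * Real.cos (y * (l m - l n)) := by
  have hre : (∑ n ∈ Finset.range K, (c n : ℂ) * Complex.exp (-(y * l n : ℝ) * Complex.I)).re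
      = ∑ n ∈ Finset.range K, c n * Real.cos (y * l n) := by
    rw [Complex.re_sum]
    refine Finset.sum_congr rfl fun n _ => ?_
    rw [Complex.re_ofReal_mul, ← Complex.ofReal_neg, Complex.exp_ofReal_mul_I_re, Real.cos_neg]
  have him : (∑ n ∈ Finset.range K, (c n : ℂ) * Complex.exp (-(y * l n : ℝ) * Complex.I)).im
      = ∑ n ∈ Finset.range K, -(c n * Real.sin (y * l n)) := by
    rw [Complex.im_sum]
    refine Finset.sum_congr rfl fun n _ => ?_
    rw [Complex.im_ofReal_mul, ← Complex.ofReal_neg, Complex.exp_ofReal_mul_I_im, Real.sin_neg]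
    ring
  rw [Complex.sq_norm, Complex.normSq_apply, hre, him, Finset.sum_mul_sum, Finset.sum_mul_sum,
    ← Finset.sum_add_distrib]
  refine Finset.sum_congr rfl fun m _ => ?_
  rw [← Finset.sum_add_distrib]
  refine Finset.sum_congr rfl fun n _ => ?_
  rw [mul_sub, Real.cos_sub]
  ring

theorem abs_integral_cos_mul_le {L : ℝ} (hL : L ≠ 0) (a b : ℝ) :
    |∫ y in a..b, Real.cos (y * L)| ≤ 2 / |L| := by
  rw [intervalIntegral.integral_comp_mul_right _ hL, integral_cos, smul_eq_mul, abs_mul, abs_inv,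
    inv_mul_eq_div]
  gcongr
  rw [abs_le]
  constructor <;> linarith [Real.neg_one_le_sin (b * L), Real.sin_le_one (b * L),
    Real.neg_one_le_sin (a * L), Real.sin_le_one (a * L)]

theorem sum_sum_range_succ_of_symm {f : ℕ → ℕ → ℝ} (hf : ∀ m n, f m n = f n m) (K : ℕ) :
    ∑ m ∈ Finset.range (K + 1), ∑ n ∈ Finset.range (K + 1), f m n
      = ∑ m ∈ Finset.range K, ∑ n ∈ Finset.range K, f m n
        + (f K K + 2 * ∑ m ∈ Finset.range K, f m K) := by
  simp only [Finset.sum_range_succ, Finset.sum_add_distrib]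
  rw [Finset.sum_congr rfl fun n _ => hf K n]
  ring

/-- The diagonal gives the interval length. Each off-diagonal cosine integrates to at most 2 over
the frequency gap, and every pair occurs twice, hence the 4. -/
theorem integral_norm_sq_sum_mul_exp_le {c l : ℕ → ℝ} (hc : ∀ n, 0 ≤ c n) (hl : StrictMono l)
    {a b : ℝ} (K : ℕ) :
    ∫ y in a..b,
        ‖∑ n ∈ Finset.range K, (c n : ℂ) * Complex.exp (-(y * l n : ℝ) * Complex.I)‖ ^ 2
      ≤ ∑ n ∈ Finset.range K,
          (c n ^ 2 * (b - a) + 4 * ∑ m ∈ Finset.range n, c m * c n / (l n - l m)) := by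
  have hint : ∀ m n : ℕ, IntervalIntegrable (fun y => c m * c n * Real.cos (y * (l m - l n)))
      MeasureTheory.volume a b := fun m n => (by fun_prop : Continuous _).intervalIntegrable _ _
  have h1 : ∀ K : ℕ, ∫ y in a..b,
        ‖∑ n ∈ Finset.range K, (c n : ℂ) * Complex.exp (-(y * l n : ℝ) * Complex.I)‖ ^ 2
      = ∑ m ∈ Finset.range K, ∑ n ∈ Finset.range K,
          c m * c n * ∫ y in a..b, Real.cos (y * (l m - l n)) := fun K => by
    simp_rw [norm_sq_sum_mul_exp]
    rw [intervalIntegral.integral_finsetSum fun m _ =>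
      (by fun_prop : Continuous _).intervalIntegrable _ _]
    refine Finset.sum_congr rfl fun m _ => ?_
    rw [intervalIntegral.integral_finsetSum fun n _ => hint m n]
    exact Finset.sum_congr rfl fun n _ => intervalIntegral.integral_const_mul _ _
  rw [h1]
  induction K with
  | zero => simp
  | succ K ih =>
    rw [sum_sum_range_succ_of_symm (fun m n => ?_), Finset.sum_range_succ]
    · refine add_le_add ih (add_le_add (by simp [sq]) ?_)
      rw [show (4 : ℝ) = 2 * 2 by norm_num, mul_assoc]
      refine mul_le_mul_of_nonneg_left ?_ zero_le_two
      rw [Finset.mul_sum]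
      refine Finset.sum_le_sum fun m hm => ?_
      have hlt : l m < l K := hl (Finset.mem_range.1 hm)
      have h2 := abs_integral_cos_mul_le (sub_ne_zero.2 hlt.ne) a b
      rw [abs_sub_comm, abs_of_pos (sub_pos.2 hlt)] at h2
      calc _ ≤ c m * c K * (2 / (l K - l m)) :=
            mul_le_mul_of_nonneg_left ((le_abs_self _).trans h2) (mul_nonneg (hc m) (hc K))
        _ = _ := by ring
    · rw [mul_comm (c m), ← neg_sub (l n) (l m)]
      simp_rw [mul_neg, Real.cos_neg]

/-- From `log (y / x) ≥ (y - x) / y` the left side is at most `√(y / x) / (y - x)`, and `√(y / x) ≤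
1 + (y - x) / (2x)` by AM-GM. -/
theorem rpow_neg_half_mul_div_log_sub_le {x y : ℝ} (hx : 0 < x) (hxy : x < y) :
    x ^ (-(1 / 2) : ℝ) * y ^ (-(1 / 2) : ℝ) / (Real.log y - Real.log x)
      ≤ 1 / (y - x) + 1 / 2 * (1 / x) := by
  have hy : 0 < y := hx.trans hxy
  have hd : 0 < y - x := sub_pos.2 hxy
  have h1 := Real.one_sub_inv_le_log_of_pos (x := y / x) (by positivity)
  rw [Real.log_div hy.ne' hx.ne', inv_div] at h1
  have h2 : (y - x) / y ≤ Real.log y - Real.log x := by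
    refine le_trans (le_of_eq ?_) h1
    field_simp
  rw [Real.rpow_neg hx.le, Real.rpow_neg hy.le, ← Real.sqrt_eq_rpow, ← Real.sqrt_eq_rpow]
  have sx := Real.sqrt_pos.2 hx
  have sy := Real.sqrt_pos.2 hy
  have ex := Real.sq_sqrt hx.le
  have ey := Real.sq_sqrt hy.le
  calc (√x)⁻¹ * (√y)⁻¹ / (Real.log y - Real.log x)
      ≤ (√x)⁻¹ * (√y)⁻¹ / ((y - x) / y) := by gcongr
    _ = √y / √x / (y - x) := by
        field_simp
        rw [ey]
    _ ≤ (1 + (y - x) / (2 * x)) / (y - x) := by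
        gcongr
        rw [div_le_iff₀ sx]
        have : 1 + (y - x) / (2 * x) = (√x ^ 2 + √y ^ 2) / (2 * √x ^ 2) := by
          rw [ex, ey]; field_simp; ring
        rw [this, div_mul_eq_mul_div, le_div_iff₀ (by positivity)]
        nlinarith [mul_nonneg sx.le (sq_nonneg (√x - √y))]
    _ = _ := by field_simp

theorem sum_one_div_range_sub (n : ℕ) :
    ∑ m ∈ Finset.range n, 1 / ((n : ℝ) - m) = ∑ m ∈ Finset.range n, 1 / ((m : ℝ) + 1) := by
  rw [← Finset.sum_range_reflect]
  refine Finset.sum_congr rfl fun m hm => ?_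
  have := Finset.mem_range.1 hm
  rw [Nat.cast_sub (by omega), Nat.cast_sub (by omega)]
  push_cast
  ring_nf

theorem sum_one_div_range_le_log {K : ℕ} :
    ∑ m ∈ Finset.range K, 1 / ((m : ℝ) + 1) ≤ 1 + Real.log K := by
  have := harmonic_le_one_add_log K
  simpa [harmonic] using this

/-- For each `n` the off-diagonal sum is at most `4 * (1 + 1/2) = 6` times a harmonic sum. The
resulting `K log K` is of the order of the main term when `K` is comparable to the interval length,
so no Hilbert-type inequality is needed. -/
theorem integral_norm_sq_sum_mul_exp_log_le {c : ℕ → ℝ} {A : ℝ} {K : ℕ} (hc : ∀ n, 0 ≤ c n)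
    (hcA : ∀ n < K, c n ≤ A * ((n : ℝ) + 1) ^ (-(1 / 2) : ℝ)) {a b : ℝ} (hab : a ≤ b) :
    ∫ y in a..b, ‖∑ n ∈ Finset.range K,
        (c n : ℂ) * Complex.exp (-(y * Real.log (n + 1) : ℝ) * Complex.I)‖ ^ 2
      ≤ A ^ 2 * (b - a + 6 * K) * (1 + Real.log K) := by
  have hl : StrictMono fun n : ℕ => Real.log ((n : ℝ) + 1) := fun m n hmn =>
    Real.log_lt_log (by positivity) (by gcongr)
  have hb : 0 ≤ b - a := sub_nonneg.2 hab
  refine (integral_norm_sq_sum_mul_exp_le hc hl K).trans ?_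
  set H := ∑ m ∈ Finset.range K, 1 / ((m : ℝ) + 1) with hH
  have hterm : ∀ n ∈ Finset.range K,
      c n ^ 2 * (b - a) + 4 * ∑ m ∈ Finset.range n,
        c m * c n / (Real.log ((n : ℝ) + 1) - Real.log ((m : ℝ) + 1))
      ≤ A ^ 2 * (b - a) * (1 / ((n : ℝ) + 1)) + 6 * A ^ 2 * H := by
    intro n hn
    have hnK := Finset.mem_range.1 hn
    have hp : (0 : ℝ) < n + 1 := by positivity
    refine add_le_add ?_ ?_
    · have : c n ^ 2 ≤ A ^ 2 * (1 / ((n : ℝ) + 1)) := by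
        calc c n ^ 2 ≤ (A * ((n : ℝ) + 1) ^ (-(1 / 2) : ℝ)) ^ 2 :=
              pow_le_pow_left₀ (hc n) (hcA n hnK) 2
          _ = A ^ 2 * (1 / ((n : ℝ) + 1)) := by
              rw [mul_pow, ← Real.rpow_natCast (((n : ℝ) + 1) ^ _) 2, ← Real.rpow_mul hp.le]
              norm_num [Real.rpow_neg_one]
      nlinarith
    · have hm : ∀ m ∈ Finset.range n,
          c m * c n / (Real.log ((n : ℝ) + 1) - Real.log ((m : ℝ) + 1))
          ≤ A ^ 2 * (1 / ((n : ℝ) - m) + 1 / 2 * (1 / ((m : ℝ) + 1))) := by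
        intro m hm
        have hmn := Finset.mem_range.1 hm
        have hmn' : (m : ℝ) + 1 < n + 1 := by gcongr
        have hd := sub_pos.2 (hl hmn)
        have key := rpow_neg_half_mul_div_log_sub_le (by positivity : (0 : ℝ) < (m : ℝ) + 1) hmn'
        rw [add_sub_add_right_eq_sub] at key
        calc c m * c n / (Real.log ((n : ℝ) + 1) - Real.log ((m : ℝ) + 1))
            ≤ (A * ((m : ℝ) + 1) ^ (-(1 / 2) : ℝ)) * (A * ((n : ℝ) + 1) ^ (-(1 / 2) : ℝ))
              / (Real.log ((n : ℝ) + 1) - Real.log ((m : ℝ) + 1)) := by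
              have q1 := hcA m (hmn.trans hnK)
              have q2 := hcA n hnK
              exact div_le_div_of_nonneg_right
                (mul_le_mul q1 q2 (hc n) ((hc m).trans q1)) hd.le
          _ = A ^ 2 * (((m : ℝ) + 1) ^ (-(1 / 2) : ℝ) * ((n : ℝ) + 1) ^ (-(1 / 2) : ℝ)
              / (Real.log ((n : ℝ) + 1) - Real.log ((m : ℝ) + 1))) := by ring
          _ ≤ _ := by gcongr
      have hHn : ∑ m ∈ Finset.range n, 1 / ((m : ℝ) + 1) ≤ H :=
        Finset.sum_le_sum_of_subset_of_nonneg (Finset.range_mono hnK.le)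
          fun _ _ _ => by positivity
      calc _ ≤ 4 * ∑ m ∈ Finset.range n,
            A ^ 2 * (1 / ((n : ℝ) - m) + 1 / 2 * (1 / ((m : ℝ) + 1))) := by
            gcongr with m hm'
            exact hm m hm'
        _ = 6 * A ^ 2 * ∑ m ∈ Finset.range n, 1 / ((m : ℝ) + 1) := by
            rw [← Finset.mul_sum, Finset.sum_add_distrib, ← Finset.mul_sum, sum_one_div_range_sub]
            ring
        _ ≤ _ := by gcongr
  calc _ ≤ ∑ n ∈ Finset.range K, (A ^ 2 * (b - a) * (1 / ((n : ℝ) + 1)) + 6 * A ^ 2 * H) :=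
        Finset.sum_le_sum hterm
    _ = A ^ 2 * (b - a + 6 * K) * H := by
        rw [Finset.sum_add_distrib, ← Finset.mul_sum, Finset.sum_const, Finset.card_range,
          nsmul_eq_mul]
        ring
    _ ≤ _ := by
        gcongr
        exact sum_one_div_range_le_log

theorem natCast_succ_cpow_neg_eq_mul_exp (n : ℕ) (σ y : ℝ) :
    ((n + 1 : ℕ) : ℂ) ^ (-(σ + Complex.I * y))
      = (((n : ℝ) + 1) ^ (-σ) : ℝ) * Complex.exp (-(y * Real.log (n + 1) : ℝ) * Complex.I) := by
  have h1 : ((n + 1 : ℕ) : ℂ) ≠ 0 := by exact_mod_cast n.succ_ne_zero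
  have h2 : (0 : ℝ) < (n : ℝ) + 1 := by positivity
  rw [Complex.cpow_def_of_ne_zero h1, Real.rpow_def_of_pos h2, Complex.ofReal_exp,
    ← Complex.exp_add, ← Complex.ofReal_natCast (n + 1), ← Complex.ofReal_log (by positivity)]
  push_cast
  ring_nf

/-- The constant in the bound for the mean square of `ζ` near the critical line. -/
noncomputable def zetaMeanSquareConst : ℝ := 258 * Real.exp 3 ^ 2 + 2 * (1108 * Real.exp 3) ^ 2

theorem zetaMeanSquareConst_pos : 0 < zetaMeanSquareConst := by
  unfold zetaMeanSquareConst
  positivity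

theorem lintegral_enorm_sq_riemannZeta_le {T σ v : ℝ} (hT : 100 ≤ T)
    (hσ : |σ - 1 / 2| ≤ 1 / Real.log T) (hv : |v| ≤ 2) :
    ∫⁻ t in Set.Icc T (2 * T), ‖riemannZeta (σ + Complex.I * (t + v : ℝ))‖ₑ ^ 2
      ≤ ENNReal.ofReal (zetaMeanSquareConst * (T * Real.log T)) := by
  obtain ⟨hv1, hv2⟩ := abs_le.1 hv
  have hl := four_le_log hT
  set K := ⌈6 * T⌉₊ with hK
  have hK1 : 6 * T ≤ K := Nat.le_ceil _
  have hK2 : (K : ℝ) < 6 * T + 1 := Nat.ceil_lt_add_one (by linarith)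
  set A := Real.exp 3 with hA
  set B := 1108 * A with hB
  set c : ℕ → ℝ := fun n => ((n : ℝ) + 1) ^ (-σ) with hc
  set D : ℝ → ℂ := fun y => ∑ n ∈ Finset.range K,
    (c n : ℂ) * Complex.exp (-(y * Real.log (n + 1) : ℝ) * Complex.I) with hD
  have hDc : Continuous D := by
    simp only [hD]
    fun_prop
  have hpt : ∀ t ∈ Set.Icc T (2 * T), ‖riemannZeta (σ + Complex.I * (t + v : ℝ))‖ₑ ^ 2
      ≤ ENNReal.ofReal (2 * ‖D (t + v)‖ ^ 2 + 2 * B ^ 2) := by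
    intro t ht
    have h := norm_riemannZeta_sub_sum_ceil_le hT hσ (y := t + v)
      (by linarith [ht.1]) (by linarith [ht.2])
    have hsum : ∑ n ∈ Finset.range ⌈6 * T⌉₊,
        ((n + 1 : ℕ) : ℂ) ^ (-(σ + Complex.I * (t + v : ℝ))) = D (t + v) :=
      Finset.sum_congr rfl fun n _ => natCast_succ_cpow_neg_eq_mul_exp n σ (t + v)
    rw [hsum] at h
    set Z := riemannZeta (σ + Complex.I * (t + v : ℝ))
    have h2 : ‖Z‖ ≤ ‖D (t + v)‖ + B := by
      calc ‖Z‖ = ‖(Z - D (t + v)) + D (t + v)‖ := by ring_nf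
        _ ≤ _ := norm_add_le _ _
        _ ≤ _ := by linarith
    rw [← ofReal_norm, ← ENNReal.ofReal_pow (norm_nonneg _)]
    refine ENNReal.ofReal_le_ofReal ?_
    calc ‖Z‖ ^ 2 ≤ (‖D (t + v)‖ + B) ^ 2 := pow_le_pow_left₀ (norm_nonneg _) h2 2
      _ ≤ _ := by nlinarith [sq_nonneg (‖D (t + v)‖ - B)]
  have hcont : Continuous fun t => 2 * ‖D (t + v)‖ ^ 2 + 2 * B ^ 2 := by fun_prop
  have hms := integral_norm_sq_sum_mul_exp_log_le (c := c) (A := A) (K := K)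
    (fun n => by simp only [hc]; positivity)
    (fun n hn => rpow_neg_le_exp_three_mul (by linarith) hσ (by simp) (by
      have h1 : (n : ℝ) + 1 ≤ K := by exact_mod_cast hn
      have h2 : 6 * T + 1 ≤ T ^ 3 := by nlinarith [sq_nonneg T]
      linarith)) (a := T + v) (b := 2 * T + v) (by linarith)
  have hlogK : Real.log K ≤ 2 * Real.log T := by
    have h2 : (K : ℝ) ≤ T ^ 2 := by nlinarith
    have := Real.log_le_log (by linarith) h2
    rwa [Real.log_pow, Nat.cast_ofNat] at this
  have hint : ∫ t in T..(2 * T), ‖D (t + v)‖ ^ 2 ≤ 129 * A ^ 2 * (T * Real.log T) := by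
    rw [intervalIntegral.integral_comp_add_right (fun y => ‖D y‖ ^ 2)]
    refine hms.trans ?_
    -- Here `6 * K ≤ 36 * T + 6`, so the length factor is at most `43 * T`, and `43 * 3 = 129`.
    calc A ^ 2 * (2 * T + v - (T + v) + 6 * K) * (1 + Real.log K)
        ≤ A ^ 2 * (43 * T) * (3 * Real.log T) := by
          refine mul_le_mul (mul_le_mul_of_nonneg_left (by linarith) (by positivity))
            (by linarith) ?_ (by positivity)
          have : (0 : ℝ) ≤ Real.log K := Real.log_nonneg (by linarith)
          linarith
      _ = _ := by ring
  refine (MeasureTheory.setLIntegral_mono_ae (hcont.measurable.ennreal_ofReal.aemeasurable)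
    (Eventually.of_forall hpt)).trans ?_
  rw [← MeasureTheory.ofReal_integral_eq_lintegral_ofReal
    (hcont.continuousOn.integrableOn_compact isCompact_Icc)
    (Eventually.of_forall fun t => by positivity),
    MeasureTheory.integral_Icc_eq_integral_Ioc,
    ← intervalIntegral.integral_of_le (by linarith)]
  refine ENNReal.ofReal_le_ofReal ?_
  rw [intervalIntegral.integral_add
    ((by fun_prop : Continuous fun t => 2 * ‖D (t + v)‖ ^ 2).intervalIntegrable _ _)
    (by simp), intervalIntegral.integral_const_mul, intervalIntegral.integral_const, smul_eq_mul,
    zetaMeanSquareConst]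
  have h3 : (2 * T - T) * (2 * B ^ 2) ≤ 2 * B ^ 2 * (T * Real.log T) := by
    have : T ≤ T * Real.log T := le_mul_of_one_le_right (by linarith) (by linarith)
    nlinarith [sq_nonneg B]
  linarith

/-! ### The sub-mean value property over squares -/

/-- The mean value property of the holomorphic function `f * f`, followed by the triangle
inequality. The angle runs over `(-π, π)` to match `polarCoord`. -/
theorem enorm_sq_le_lintegral_circle {f : ℂ → ℂ} {z : ℂ} {ρ : ℝ}
    (hf : DiffContOnCl ℂ f (Metric.ball z |ρ|)) :
    ENNReal.ofReal (2 * Real.pi) * ‖f z‖ₑ ^ 2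
      ≤ ∫⁻ θ in Set.Ioo (-Real.pi) Real.pi, ‖f (circleMap z ρ θ)‖ₑ ^ 2 := by
  have hpi := Real.pi_pos
  have h1 : Real.circleAverage (fun w => f w * f w) z ρ = f z * f z :=
    (hf.smul hf).circleAverage
  have h2 : ∫ θ in (-Real.pi)..Real.pi, f (circleMap z ρ θ) * f (circleMap z ρ θ)
      = (2 * Real.pi) • (f z * f z) := by
    rw [← h1, Real.circleAverage_eq_integral_add (-Real.pi), smul_smul,
      mul_inv_cancel₀ (by positivity), one_smul,
      intervalIntegral.integral_comp_add_right
        (fun θ => f (circleMap z ρ θ) * f (circleMap z ρ θ))]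
    congr 1 <;> ring
  rw [intervalIntegral.integral_of_le (by linarith), MeasureTheory.integral_Ioc_eq_integral_Ioo]
    at h2
  calc ENNReal.ofReal (2 * Real.pi) * ‖f z‖ₑ ^ 2 = ‖(2 * Real.pi) • (f z * f z)‖ₑ := by
        rw [enorm_smul, Real.enorm_of_nonneg (by positivity : 0 ≤ 2 * Real.pi), enorm_mul, sq]
    _ ≤ ∫⁻ θ in Set.Ioo (-Real.pi) Real.pi, ‖f (circleMap z ρ θ) * f (circleMap z ρ θ)‖ₑ := by
        rw [← h2]
        exact MeasureTheory.enorm_integral_le_lintegral_enorm _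
    _ = _ := by simp_rw [enorm_mul, sq]

theorem lintegral_ofReal_Ioo_zero {r : ℝ} (hr : 0 ≤ r) :
    ∫⁻ ρ in Set.Ioo 0 r, ENNReal.ofReal ρ = ENNReal.ofReal (r ^ 2 / 2) := by
  have hi : MeasureTheory.IntegrableOn (fun ρ : ℝ => ρ) (Set.Ioo 0 r) :=
    (continuous_id.continuousOn.integrableOn_compact isCompact_Icc).mono_set
      Set.Ioo_subset_Icc_self
  rw [← MeasureTheory.ofReal_integral_eq_lintegral_ofReal hi
    ((MeasureTheory.ae_restrict_iff' measurableSet_Ioo).2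
      (Eventually.of_forall fun x hx => hx.1.le)),
    ← MeasureTheory.integral_Ioc_eq_integral_Ioo, ← intervalIntegral.integral_of_le hr]
  simp

/-- The circle inequality is integrated against `ρ dρ` over the disc of radius `r`, and the disc
lies in the square. A square gives a product domain for the later integration. -/
theorem enorm_sq_mul_le_lintegral_square {f : ℂ → ℂ} (hfm : Measurable f) {z : ℂ} {r : ℝ}
    (hr : 0 < r) (hf : DifferentiableOn ℂ f (Metric.ball z r)) :
    ‖f z‖ₑ ^ 2 * ENNReal.ofReal (Real.pi * r ^ 2)
      ≤ ∫⁻ p in Set.Icc (-r) r ×ˢ Set.Icc (-r) r,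
          ‖f (z + ((p.1 : ℝ) + Complex.I * (p.2 : ℝ)))‖ₑ ^ 2 := by
  set Q : Set (ℝ × ℝ) := Set.Icc (-r) r ×ˢ Set.Icc (-r) r with hQ
  have hQm : MeasurableSet Q := measurableSet_Icc.prod measurableSet_Icc
  set k : ℝ × ℝ → ENNReal := fun p => ‖f (z + ((p.1 : ℝ) + Complex.I * (p.2 : ℝ)))‖ₑ ^ 2 with hk
  rw [← MeasureTheory.lintegral_indicator hQm, ← lintegral_comp_polarCoord_symm]
  have hsub : Set.Ioo 0 r ×ˢ Set.Ioo (-Real.pi) Real.pi ⊆ polarCoord.target := by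
    rw [polarCoord_target]
    exact Set.prod_mono (fun x hx => hx.1) subset_rfl
  have hm : Measurable fun p : ℝ × ℝ => ENNReal.ofReal p.1 * ‖f (circleMap z p.1 p.2)‖ₑ ^ 2 := by
    have : Continuous fun p : ℝ × ℝ => circleMap z p.1 p.2 := by
      unfold circleMap
      fun_prop
    exact (measurable_fst.ennreal_ofReal).mul ((hfm.comp this.measurable).enorm.pow_const 2)
  calc ‖f z‖ₑ ^ 2 * ENNReal.ofReal (Real.pi * r ^ 2)
      = ∫⁻ ρ in Set.Ioo 0 r,
          ENNReal.ofReal ρ * (ENNReal.ofReal (2 * Real.pi) * ‖f z‖ₑ ^ 2) := by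
        rw [MeasureTheory.lintegral_mul_const _ (by fun_prop), lintegral_ofReal_Ioo_zero hr.le,
          ← mul_assoc, ← ENNReal.ofReal_mul (by positivity), mul_comm]
        congr 2
        ring
    _ ≤ ∫⁻ ρ in Set.Ioo 0 r, ∫⁻ θ in Set.Ioo (-Real.pi) Real.pi,
          ENNReal.ofReal ρ * ‖f (circleMap z ρ θ)‖ₑ ^ 2 := by
        refine MeasureTheory.setLIntegral_mono' measurableSet_Ioo fun ρ hρ => ?_
        rw [MeasureTheory.lintegral_const_mul' _ _ ENNReal.ofReal_ne_top]
        gcongr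
        refine enorm_sq_le_lintegral_circle (hf.diffContOnCl_ball ?_)
        rw [abs_of_pos hρ.1]
        exact Metric.closedBall_subset_ball hρ.2
    _ = ∫⁻ p in Set.Ioo 0 r ×ˢ Set.Ioo (-Real.pi) Real.pi,
          ENNReal.ofReal p.1 * ‖f (circleMap z p.1 p.2)‖ₑ ^ 2 := by
        rw [MeasureTheory.Measure.volume_eq_prod, MeasureTheory.setLIntegral_prod _
          hm.aemeasurable]
    _ = ∫⁻ p in Set.Ioo 0 r ×ˢ Set.Ioo (-Real.pi) Real.pi,
          ENNReal.ofReal p.1 • Q.indicator k (polarCoord.symm p) := by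
        refine MeasureTheory.setLIntegral_congr_fun (measurableSet_Ioo.prod measurableSet_Ioo)
          fun p hp => ?_
        obtain ⟨⟨h0, h1⟩, -⟩ := hp
        have hmem : polarCoord.symm p ∈ Q := by
          rw [polarCoord_symm_apply]
          have hb : ∀ x : ℝ, |x| ≤ 1 → p.1 * x ∈ Set.Icc (-r) r := fun x hx => by
            rw [Set.mem_Icc, ← abs_le, abs_mul, abs_of_pos h0]
            nlinarith [abs_nonneg x]
          exact ⟨hb _ (Real.abs_cos_le_one _), hb _ (Real.abs_sin_le_one _)⟩
        rw [Set.indicator_of_mem hmem]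
        simp only [smul_eq_mul, hk, polarCoord_symm_apply, circleMap, Complex.exp_mul_I]
        push_cast
        ring_nf
    _ ≤ _ := MeasureTheory.lintegral_mono_set hsub

/-! ### The local maximum of `ζ` -/

theorem measurable_riemannZeta : Measurable riemannZeta :=
  measurable_of_continuousOn_compl_singleton 1 fun _ hs =>
    (differentiableAt_riemannZeta hs).continuousAt.continuousWithinAt

/-- `|ζ|²` at the point of ordinate `t + p.2` whose distance to the critical line is `p.1`. -/
noncomputable def zetaSqNear (t : ℝ) (p : ℝ × ℝ) : ENNReal :=
  ‖riemannZeta ((1 / 2 + p.1 : ℝ) + Complex.I * (t + p.2 : ℝ))‖ₑ ^ 2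

theorem measurable_zetaSqNear : Measurable (Function.uncurry zetaSqNear) := by
  refine (measurable_riemannZeta.comp ?_).enorm.pow_const 2
  exact (by fun_prop : Continuous fun q : ℝ × ℝ × ℝ =>
    (((1 / 2 + q.2.1 : ℝ) : ℂ) + Complex.I * (q.1 + q.2.2 : ℝ))).measurable

/-- The square around the maximising point has ordinates within `1 + r ≤ 2` of `t`. Passing to the
full rectangle makes the bound independent of that point, so no measurable selection of it is
needed. -/
theorem ofReal_zetaLocalMax_sq_mul_le (t : ℝ) {r : ℝ} (hr : 0 < r) (hr' : r ≤ 1 / 4) :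
    ENNReal.ofReal (zetaLocalMax t ^ 2 * (Real.pi * r ^ 2))
      ≤ ∫⁻ p in Set.Icc (-r) r ×ˢ Set.Icc (-2) 2, zetaSqNear t p := by
  obtain ⟨u, hu, hmax⟩ := (isGreatest_zetaLocalMax t).1
  simp only at hmax
  obtain ⟨hu1, hu2⟩ : -1 ≤ t - u ∧ t - u ≤ 1 := abs_le.1 hu
  have hdiff : DifferentiableOn ℂ riemannZeta (Metric.ball (1 / 2 + Complex.I * (u : ℂ)) r) := by
    intro s hs
    refine (differentiableAt_riemannZeta ?_).differentiableWithinAt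
    rintro rfl
    -- The pole lies at distance at least `1/2 > r` from the critical line.
    have h1 := (Complex.abs_re_le_norm _).trans_lt (mem_ball_iff_norm.1 hs)
    norm_num at h1
    linarith
  have h := enorm_sq_mul_le_lintegral_square measurable_riemannZeta hr hdiff
  rw [← hmax, ENNReal.ofReal_mul (by positivity), ENNReal.ofReal_pow (norm_nonneg _), ofReal_norm]
  refine h.trans ?_
  rw [← MeasureTheory.lintegral_indicator (measurableSet_Icc.prod measurableSet_Icc),
    ← MeasureTheory.lintegral_indicator (measurableSet_Icc.prod measurableSet_Icc),
    ← MeasureTheory.lintegral_add_right_eq_self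
      ((Set.Icc (-r) r ×ˢ Set.Icc (-2) 2).indicator (zetaSqNear t)) ((0, u - t) : ℝ × ℝ)]
  refine MeasureTheory.lintegral_mono fun p => ?_
  by_cases hp : p ∈ Set.Icc (-r) r ×ˢ Set.Icc (-r) r
  · have hp' : p + (0, u - t) ∈ Set.Icc (-r) r ×ˢ Set.Icc (-2 : ℝ) 2 := by
      obtain ⟨h1, h2, h3⟩ := hp
      refine ⟨by simpa using h1, ?_, ?_⟩ <;> simp only [Prod.snd_add] <;> linarith
    rw [Set.indicator_of_mem hp, Set.indicator_of_mem hp', zetaSqNear]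
    refine le_of_eq ?_
    congr 3
    simp only [Prod.fst_add, Prod.snd_add]
    push_cast
    ring
  · rw [Set.indicator_of_notMem hp]
    exact zero_le

theorem lintegral_lintegral_zetaSqNear_le {T : ℝ} (hT : 100 ≤ T) :
    ∫⁻ t in Set.Icc T (2 * T),
        ∫⁻ p in Set.Icc (-(1 / Real.log T)) (1 / Real.log T) ×ˢ Set.Icc (-2) 2, zetaSqNear t p
      ≤ ENNReal.ofReal (8 * zetaMeanSquareConst * T) := by
  have hl := four_le_log hT
  set r := 1 / Real.log T with hr
  have hr0 : 0 < r := by positivity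
  rw [MeasureTheory.lintegral_lintegral_swap measurable_zetaSqNear.aemeasurable]
  calc _ ≤ ∫⁻ p in Set.Icc (-r) r ×ˢ Set.Icc (-2 : ℝ) 2,
        ENNReal.ofReal (zetaMeanSquareConst * (T * Real.log T)) := by
        refine MeasureTheory.setLIntegral_mono' (measurableSet_Icc.prod measurableSet_Icc)
          fun p hp => ?_
        refine lintegral_enorm_sq_riemannZeta_le hT ?_ (abs_le.2 hp.2)
        rw [add_sub_cancel_left]
        exact abs_le.2 hp.1
    _ = ENNReal.ofReal (8 * zetaMeanSquareConst * T) := by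
        have hC := zetaMeanSquareConst_pos
        rw [MeasureTheory.setLIntegral_const, MeasureTheory.Measure.volume_eq_prod,
          MeasureTheory.Measure.prod_prod, Real.volume_Icc, Real.volume_Icc,
          ← ENNReal.ofReal_mul (by linarith), ← ENNReal.ofReal_mul (by positivity)]
        congr 1
        rw [hr]
        field_simp
        ring

theorem unifProb_nonneg {T : ℝ} (hT : 0 ≤ T) (E : Set ℝ) : 0 ≤ unifProb T E :=
  mul_nonneg (by positivity) MeasureTheory.measureReal_nonneg

/-- Markov's inequality is applied to the rectangle integral `G`, which is measurable in `t`;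
measurability of `zetaLocalMax` itself is never needed. -/
theorem unifProb_zetaLocalMax_le {T v : ℝ} (hT : 100 ≤ T) (hv : 0 < v) :
    unifProb T {t : ℝ | zetaLocalMax t > v * Real.log T}
      ≤ 8 * zetaMeanSquareConst * (1 / v ^ 2) := by
  have hl := four_le_log hT
  have hpi := Real.pi_gt_three
  have hC := zetaMeanSquareConst_pos
  set r := 1 / Real.log T with hr
  have hr0 : 0 < r := by positivity
  have hr1 : r ≤ 1 / 4 := one_div_le_one_div_of_le (by norm_num) hl
  set G : ℝ → ENNReal := fun t => ∫⁻ p in Set.Icc (-r) r ×ˢ Set.Icc (-2) 2, zetaSqNear t p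
  have hG : Measurable G := measurable_zetaSqNear.lintegral_prod_right'
  -- With `r = 1 / log T`, this is `(v log T)² · π r²`: the logarithms cancel exactly.
  set ε := ENNReal.ofReal (v ^ 2 * Real.pi) with hε
  have hsub : Set.Icc T (2 * T) ∩ {t : ℝ | zetaLocalMax t > v * Real.log T}
      ⊆ {t | ε ≤ G t} ∩ Set.Icc T (2 * T) := by
    rintro t ⟨ht, hmax⟩
    refine ⟨le_trans (ENNReal.ofReal_le_ofReal ?_) (ofReal_zetaLocalMax_sq_mul_le t hr0 hr1), ht⟩
    have h1 : (v * Real.log T) ^ 2 ≤ zetaLocalMax t ^ 2 :=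
      pow_le_pow_left₀ (by positivity) (le_of_lt hmax) 2
    calc v ^ 2 * Real.pi = (v * Real.log T) ^ 2 * (Real.pi * r ^ 2) := by
          rw [hr]; field_simp
      _ ≤ _ := by gcongr
  have hvol : MeasureTheory.volume (Set.Icc T (2 * T) ∩ {t : ℝ | zetaLocalMax t > v * Real.log T})
      ≤ ENNReal.ofReal (8 * zetaMeanSquareConst * T / (v ^ 2 * Real.pi)) := by
    calc _ ≤ MeasureTheory.volume ({t | ε ≤ G t} ∩ Set.Icc T (2 * T)) :=
          MeasureTheory.measure_mono hsub
      _ = (MeasureTheory.volume.restrict (Set.Icc T (2 * T))) {t | ε ≤ G t} :=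
          (MeasureTheory.Measure.restrict_apply (measurableSet_le measurable_const hG)).symm
      _ ≤ (∫⁻ t in Set.Icc T (2 * T), G t) / ε :=
          MeasureTheory.meas_ge_le_lintegral_div hG.aemeasurable
            (ENNReal.ofReal_pos.2 (by positivity)).ne' ENNReal.ofReal_ne_top
      _ ≤ ENNReal.ofReal (8 * zetaMeanSquareConst * T) / ε := by
          gcongr
          exact lintegral_lintegral_zetaSqNear_le hT
      _ = _ := (ENNReal.ofReal_div_of_pos (by positivity)).symm
  have hreal := ENNReal.toReal_mono ENNReal.ofReal_ne_top hvol
  rw [ENNReal.toReal_ofReal (by positivity)] at hreal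
  calc unifProb T {t : ℝ | zetaLocalMax t > v * Real.log T}
      ≤ 1 / T * (8 * zetaMeanSquareConst * T / (v ^ 2 * Real.pi)) :=
        mul_le_mul_of_nonneg_left hreal (by positivity)
    _ = 8 * zetaMeanSquareConst / (v ^ 2 * Real.pi) := by field_simp
    _ ≤ 8 * zetaMeanSquareConst / (v ^ 2 * 1) := by gcongr; linarith
    _ = _ := by ring

theorem proposition2p1 :
    ∃ C : ℝ, 0 < C ∧ ∀ V : ℝ → ℝ, Tendsto V atTop atTop →
      (∀ᶠ T : ℝ in atTop,
        unifProb T {t : ℝ | zetaLocalMax t > V T * Real.log T} ≤ C * (1 / V T ^ 2)) ∧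
      Tendsto (fun T : ℝ => unifProb T {t : ℝ | zetaLocalMax t > V T * Real.log T})
        atTop (𝓝 0) := by
  refine ⟨8 * zetaMeanSquareConst, mul_pos (by norm_num) zetaMeanSquareConst_pos, fun V hV => ?_⟩
  have hbound : ∀ᶠ T : ℝ in atTop,
      unifProb T {t : ℝ | zetaLocalMax t > V T * Real.log T}
        ≤ 8 * zetaMeanSquareConst * (1 / V T ^ 2) := by
    filter_upwards [eventually_ge_atTop 100, hV.eventually_gt_atTop 0] with T hT hVT
    exact unifProb_zetaLocalMax_le hT hVT
  refine ⟨hbound, squeeze_zero' ?_ hbound ?_⟩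
  · filter_upwards [eventually_ge_atTop 0] with T hT using unifProb_nonneg hT _
  · have h : Tendsto (fun T => 1 / V T ^ 2) atTop (𝓝 0) := by
      simp only [one_div]
      exact ((tendsto_pow_atTop two_ne_zero).comp hV).inv_tendsto_atTop
    simpa using h.const_mul (8 * zetaMeanSquareConst)
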